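/- **Proposition (naive parallel redundancy).** Let $x^N\in\{0,1\}^N$ with $N=BM$, $B,M\ge 1$, be cut into $B$ consecutive blocks $x(1),\dots,x(B)$ of length $M=N/B$, and let $D\ge 0$ be an integer with $D\le\log(N/B)$; $\log$ is to base 2. A tree structure $\mathcal S$ of depth at most $D$ is a complete and proper set of binary strings (states) of length at most $D$, and $|\mathcal S|$ is their number. For a block, $n_s^\alpha$ is the number of its positions after the first $D$ at which the symbol $\alpha$ follows the context $s$; for the entire sequence, $n_s^\alpha$ is the sum of these numbers over the blocks. The maximum likelihood (ML) entropy, in bits, of a block or of the sequence with respect to $\mathcal S$ is $-\sum_{s\in\mathcal S}\sum_{\alpha} n_s^\alpha\log\theta_s^\alpha$, where $\theta_s^\alpha=n_s^\alpha/(n_s^0+n_s^1)$. *Two-pass description.* For data of length $n$, $\theta_s^1$ is quantized with $K=\big\lceil\sqrt{2\pi^2\ln 2\,(\tfrac12-\tfrac{3}{16\ln 2})\,n}\,\big\rceil$ bins of equal mass under Jeffreys' prior, the representation level $r_s$ of a bin being its Jeffreys median. The description length with the structure $\mathcal S$ is $|\mathrm{natural}_{\mathcal S}|+|\mathcal S|\log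 K-\sum_{s\in\mathcal S}[n_s^1\log r_s+n_s^0\log(1-r_s)]$. Here $\mathrm{natural}_{\mathcal S}$ is the natural code: one bit for every node of depth less than $D$, telling whether it is a leaf. The first summand is the *model redundancy* and the second one the *parameter redundancy* of the data. An *MDL structure* minimizes the description length among the trees of depth at most $D$, up to at most $\delta$ bits, where $\delta\ge 0$ is a fixed constant. *Naive parallel compression* encodes every block $x(b)$ independently: it takes an MDL structure $\widehat{\mathcal S}_b$ of $x(b)$ alone ($n=N/B$), and writes the natural code of $\widehat{\mathcal S}_b$, the bin indices of its states, the first $D$ symbols uncoded, and the remaining symbols by arithmetic coding with the quantized parameters. PTP-MDL uses instead a single MDL structure $\widehat{\mathcal S}$ of the entire sequence ($n=N$). Let $l_N(x^N)$ be the length in bits of the naive code, and let $\widehat{\mathcal S}_n$ be one of $\widehat{\mathcal S}_1,\dots,\widehat{\mathcal S}_B$ with the largest number of states. Then the naive code is a uniquely decodable code for the sequences of length $N$, and there is a constant $C$, depending on $\delta$ only, such that for all $B$, $N$, $D$ and $x^N$ as above the following holds. 1. The pointwise redundancy $\rho_N(x^N)$ of naive parallel compression over the ML entropy with respect to the estimated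 MDL structures (the sum over $b$ of the ML entropies of $x(b)$ with respect to $\widehat{\mathcal S}_b$) satisfies $$\rho_N(x^N)\le B\Big[\log\frac NB+2\Big]+B\,\frac{|\widehat{\mathcal S}_n|}{2}\Big[\log\frac NB+C\Big].$$ 2. For every tree structure $\mathcal S$ of depth at most $D$, the excess of $l_N(x^N)$ over the ML entropy of the entire sequence with respect to $\mathcal S$ is at most $B[\log\frac NB+2]+B\frac{|\mathcal S|}{2}[\log\frac NB+C]$. In particular, the bound of part 1 also holds with this benchmark for each $\mathcal S$ with $|\mathcal S|\le|\widehat{\mathcal S}_n|$. 3. The total model and parameter redundancies of naive parallel compression are at most $B(2|\widehat{\mathcal S}_n|-1)$ and $B\frac{|\widehat{\mathcal S}_n|}{2}[\log\frac NB+C]$. Those of PTP-MDL are at most $2|\widehat{\mathcal S}|-1$ and $\frac{|\widehat{\mathcal S}|}{2}[\log N+C]$. If $\widehat{\mathcal S}_b=\widehat{\mathcal S}$ for all $b$, the model redundancy of naive compression is exactly $B$ times that of PTP-MDL, and its parameter redundancy is exactly $B$ times that of one length-$N/B$ block described with $\widehat{\mathcal S}$. -/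

import Mathlib

open scoped BigOperators

/-- The structure of a binary context tree source: a full binary tree. Its leaves are the states.
The `false` / `true` branch of a node is chosen by a past symbol `0` / `1`, the most recent past
symbol being used at the root. Full binary trees correspond to the finite complete and proper
(prefix-free) sets of states. -/
inductive ContextTree : Type
  | leaf : ContextTree
  | node (t₀ t₁ : ContextTree) : ContextTree

namespace ContextTree

/-- The states (leaves) in depth-first order. A state is written as the list of past symbols
leading to it from the root, the most recent symbol first. -/
def states : ContextTree → List (List Bool)
  | leaf => [[]]
  | node t₀ t₁ => t₀.states.map (List.cons false) ++ t₁.states.map (List.cons true)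

/-- The number of states `|S|`. -/
def numStates (S : ContextTree) : ℕ := S.states.length

/-- The maximum context depth `max_{s ∈ S} |s|`. -/
def depth : ContextTree → ℕ
  | leaf => 0
  | node t₀ t₁ => max t₀.depth t₁.depth + 1

/-- The generator state determined by a past (most recent symbol first): enter the tree at the root
and follow the past symbols until a leaf is met. -/
def generator : ContextTree → List Bool → List Bool
  | leaf, _ => []
  | node t₀ _, false :: past => false :: t₀.generator past
  | node _ t₁, true :: past => true :: t₁.generator past
  | node _ _, [] => []

/-- The natural code of a tree of depth at most `D`, in depth-first order: one bit for every node of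
depth less than `D` (`1` for an internal node, `0` for a leaf), no bit for a leaf of depth `D`. -/
def natural : ℕ → ContextTree → List Bool
  | 0, _ => []
  | _ + 1, leaf => [false]
  | D + 1, node t₀ t₁ => true :: (natural D t₀ ++ natural D t₁)

end ContextTree

namespace TreeMDL

noncomputable section

/-! ### Symbol counts -/

/-- The symbols that precede position `i` in the block `y`, the most recent one first. -/
def past {M : ℕ} (y : Fin M → Bool) (i : ℕ) : List Bool :=
  ((List.ofFn y).take i).reverse

/-- The block symbol count: the number of positions (after the first `D`) of the block `y` at which
the symbol `a` is generated in the context `s`. -/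
def blockCount (D : ℕ) {M : ℕ} (y : Fin M → Bool) (s : List Bool) (a : Bool) : ℕ :=
  (Finset.univ.filter fun i : Fin M => D ≤ (i : ℕ) ∧ y i = a ∧ s <+: past y i).card

/-- Block `b` of the sequence `x` of length `N = B * M`: the symbols number `b * M + i`, `i < M`. -/
def block {B M : ℕ} (x : Fin (B * M) → Bool) (b : Fin B) : Fin M → Bool :=
  fun i => x (finProdFinEquiv (b, i))

/-- The symbol counts in the entire sequence: the sum of the block symbol counts. -/
def totalCount (D : ℕ) {B M : ℕ} (x : Fin (B * M) → Bool) (s : List Bool) (a : Bool) : ℕ :=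
  ∑ b : Fin B, blockCount D (block x b) s a

/-! ### Maximum likelihood parameters and entropy -/

/-- The maximum likelihood estimate of the probability of the symbol `1` in state `s`
(with value `0` if nothing is generated by `s`). -/
def mlParam (cnt : List Bool → Bool → ℕ) (s : List Bool) : ℝ :=
  (cnt s true : ℝ) / ((cnt s false : ℝ) + (cnt s true : ℝ))

/-- The number of bits `- n⁰ log₂ (1 - p) - n¹ log₂ p` that the symbols generated by `s` need when
`1` is given probability `p` (with `0 log 0 = 0`). -/
def stateLength (cnt : List Bool → Bool → ℕ) (s : List Bool) (p : ℝ) : ℝ :=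
  -((cnt s false : ℝ) * Real.logb 2 (1 - p)) - (cnt s true : ℝ) * Real.logb 2 p

/-- The (unnormalized) maximum likelihood entropy, in bits, of the data with symbol counts `cnt`
with respect to the tree structure `S`: the parameters are the maximum likelihood ones. -/
def mlEntropy (cnt : List Bool → Bool → ℕ) (S : ContextTree) : ℝ :=
  (S.states.map fun s => stateLength cnt s (mlParam cnt s)).sum

/-! ### The parameter quantizer based on Jeffreys' prior -/

/-- The number `⌈√(2 π² ln 2 (1/2 - 3/(16 ln 2)) n)⌉ ≈ ⌈1.772 √n⌉` of representation levels for data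
of length `n`. -/
def levels (n : ℕ) : ℕ :=
  ⌈Real.sqrt (2 * Real.pi ^ 2 * Real.log 2 * (1 / 2 - 3 / (16 * Real.log 2)) * n)⌉₊

/-- The distribution function of Jeffreys' prior, whose density on `(0, 1)` is
`1 / (π √(θ (1 - θ)))` (the arcsine law). -/
def jeffreysCDF (θ : ℝ) : ℝ := 2 / Real.pi * Real.arcsin (Real.sqrt θ)

/-- The index in `{0, …, K - 1}` of the bin of `θ`, for `K` bins of equal mass `1 / K` under
Jeffreys' prior. -/
def binIndex (K : ℕ) (θ : ℝ) : ℕ := min ⌊(K : ℝ) * jeffreysCDF θ⌋₊ (K - 1)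

/-- The representation level of bin `k`: its median `sin² (π (2 k + 1) / (4 K))` under Jeffreys'
prior. -/
def repLevel (K k : ℕ) : ℝ := Real.sin (Real.pi * (2 * k + 1) / (4 * K)) ^ 2

/-- The quantized maximum likelihood parameter of state `s`, for data of length `n`. -/
def quantParam (n : ℕ) (cnt : List Bool → Bool → ℕ) (s : List Bool) : ℝ :=
  repLevel (levels n) (binIndex (levels n) (mlParam cnt s))

/-! ### Description lengths and the MDL structure -/

/-- The model redundancy: the length of the natural code of the tree. -/
def modelLength (D : ℕ) (S : ContextTree) : ℕ := (S.natural D).length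

/-- The parameter redundancy `|S| log₂ K`: the length of the description of the bin indices. -/
def paramLength (n : ℕ) (S : ContextTree) : ℝ := S.numStates * Real.logb 2 (levels n)

/-- The two-pass description length, with the structure `S`, of data of length `n` with symbol
counts `cnt`. -/
def mdlLength (D n : ℕ) (cnt : List Bool → Bool → ℕ) (S : ContextTree) : ℝ :=
  modelLength D S + paramLength n S +
    (S.states.map fun s => stateLength cnt s (quantParam n cnt s)).sum

/-- `S` is an MDL tree structure in the class of trees of depth at most `D`, up to `δ` bits: its
description length exceeds the minimum by at most `δ`. -/
def IsMDL (δ : ℝ) (D n : ℕ) (cnt : List Bool → Bool → ℕ) (S : ContextTree) : Prop :=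
  S.depth ≤ D ∧ ∀ S' : ContextTree, S'.depth ≤ D → mdlLength D n cnt S ≤ mdlLength D n cnt S' + δ

/-! ### The encoder -/

/-- The number `v` written with `w` bits, the most significant one first. -/
def fixedWidth (w v : ℕ) : List Bool := List.ofFn fun i : Fin w => v.testBit (w - 1 - i)

/-- The interval `[l, l + w)` to which arithmetic coding narrows the interval `[l, l + w)` it is
given (as the pair `(l, w)`), when it reads a list of symbols after the past `h` (most recent symbol
first). Here `p h` is the probability assigned to the symbol `1` after the past `h`. -/
def arithInterval (p : List Bool → ℝ) : List Bool → List Bool → ℝ × ℝ → ℝ × ℝ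
  | _, [], I => I
  | h, false :: u, (l, w) => arithInterval p (false :: h) u (l, w * (1 - p h))
  | h, true :: u, (l, w) => arithInterval p (true :: h) u (l + w * (1 - p h), w * p h)

/-- The codeword of an interval: the first `⌈log₂ (1 / w)⌉ + 1` binary digits of its midpoint. -/
def intervalCode (I : ℝ × ℝ) : List Bool :=
  let m := ⌈-Real.logb 2 I.2⌉₊ + 1
  fixedWidth m ⌊(I.1 + I.2 / 2) * 2 ^ m⌋₊

/-- The arithmetic codeword of the symbols `u` after the past `h`. -/
def arithCode (p : List Bool → ℝ) (h u : List Bool) : List Bool :=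
  intervalCode (arithInterval p h u (0, 1))

/-- The two-pass codeword of one block `y` of length `M` with the structure `S`: the natural code
of `S`; the bin indices of the states in depth-first order, as one integer in base `K`; the first `D`
symbols, uncoded; the other symbols, by arithmetic coding with the quantized parameters. -/
def encodeBlock (D : ℕ) {M : ℕ} (S : ContextTree) (y : Fin M → Bool) : List Bool :=
  let K := levels M
  let cnt := blockCount D y
  S.natural D ++
    fixedWidth (Nat.clog 2 (K ^ S.numStates))
      (Nat.ofDigits K (S.states.map fun s => binIndex K (mlParam cnt s))) ++
    (List.ofFn y).take D ++
    arithCode (fun h => quantParam M cnt (S.generator h)) (past y D) ((List.ofFn y).drop D)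

/-- The naive parallel encoder: every block `y` is encoded independently of the other blocks, with
the structure `est y` that is estimated from this block alone. -/
def naiveEncode (D : ℕ) {B M : ℕ} (est : (Fin M → Bool) → ContextTree) (x : Fin (B * M) → Bool) :
    List Bool :=
  (List.ofFn fun b : Fin B => encodeBlock D (est (block x b)) (block x b)).flatten

/-- The largest number of states among the `B` estimated tree structures. -/
def maxStates {B M : ℕ} (est : (Fin M → Bool) → ContextTree) (x : Fin (B * M) → Bool) : ℕ :=
  Finset.univ.sup fun b : Fin B => (est (block x b)).numStates

/-- The pointwise redundancy of naive parallel compression over the maximum likelihood entropy with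
respect to the estimated MDL structures, that of every block being the one estimated from it. -/
def naiveRedundancy (D : ℕ) {B M : ℕ} (est : (Fin M → Bool) → ContextTree)
    (x : Fin (B * M) → Bool) : ℝ :=
  (naiveEncode D est x).length -
    ∑ b : Fin B, mlEntropy (blockCount D (block x b)) (est (block x b))

/-- The pointwise redundancy of naive parallel compression over the maximum likelihood entropy of
the entire sequence with respect to a single structure `S`. -/
def naiveRedundancyWrt (D : ℕ) {B M : ℕ} (est : (Fin M → Bool) → ContextTree) (S : ContextTree)
    (x : Fin (B * M) → Bool) : ℝ :=
  (naiveEncode D est x).length - mlEntropy (totalCount D x) S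

/-- The model redundancy of naive parallel compression. -/
def naiveModelLength (D : ℕ) {B M : ℕ} (est : (Fin M → Bool) → ContextTree)
    (x : Fin (B * M) → Bool) : ℕ :=
  ∑ b : Fin B, modelLength D (est (block x b))

/-- The parameter redundancy of naive parallel compression. -/
def naiveParamLength {B M : ℕ} (est : (Fin M → Bool) → ContextTree)
    (x : Fin (B * M) → Bool) : ℝ :=
  ∑ b : Fin B, paramLength M (est (block x b))

end

end TreeMDL

/-!
The codeword of a block consists of the natural code of a tree, a fixed-width integer, `D` raw
symbols and an arithmetic codeword.

*Unique decodability.* Each of the four parts is prefix-free once the previous ones are known. For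
the arithmetic codeword: every bit string that starts with the codeword of an interval is the binary
expansion of a point of this interval (`bitValue_intervalCode_append_mem`), and the intervals of
distinct strings of the same length are disjoint (`arithInterval_disjoint`). The decoder can run the
arithmetic decoder because the bin indices of the states determine the probabilities after all pasts
of length at least `D`. So the block code is prefix-free (`encodeBlock_append_inj`), and so is
the concatenation of `B` block codewords (`naiveEncode_append_inj`).

*Length of a block codeword.* The final arithmetic interval has as width the product of the
probabilities of the symbols. Grouping the factors by the generator state shows that the codeword
exceeds the two-pass description length and the `D ≤ log₂ M` raw symbols by at most three bits of
rounding (`length_encodeBlock_le`). For a tree with `k` states, the natural code has at most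
`2 k - 1` bits, the bin indices cost `k log₂ K ≤ k (log₂ M / 2 + 2)` bits, and quantization costs at
most five bits per state (`stateLength_quantParam_le`). The latter holds because the relative entropy
is at most the `χ²`-distance, and in the coordinate `θ = sin² a`, in which the bins are intervals of
the same length, the `χ²`-distance of the centre of a bin to the points of the bin is `O(1 / K²)`,
uniformly in the bin (`sq_sub_repLevel_le`). Altogether the description length is at most the maximum
likelihood entropy plus `k / 2 (log₂ M + 18) - 1` (`mdlLength_le_mlEntropy`).

*Redundancy.* For the estimated structures, these bounds are added over the blocks. For another tree,
the MDL property replaces the description length with the estimated structure by the one with this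
tree, up to `δ`, and by Gibbs' inequality the entropies of the blocks add up to at most the entropy
of the sequence (`sum_mlEntropy_block_le`).
-/

/-! ### Quantization of the parameters -/

namespace TreeMDL

/-- The constant under the root in `levels`, in closed form and with numerical bounds. -/
lemma levels_const_bounds :
    2 * Real.pi ^ 2 * Real.log 2 * (1 / 2 - 3 / (16 * Real.log 2)) =
        Real.pi ^ 2 * (Real.log 2 - 3 / 8) ∧
      Real.pi ^ 2 * (3 / 10) ≤ Real.pi ^ 2 * (Real.log 2 - 3 / 8) ∧
      Real.pi ^ 2 * (Real.log 2 - 3 / 8) ≤ 9 := by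
  have h1 := Real.log_two_gt_d9
  have h2 := Real.log_two_lt_d9
  have hpi : Real.pi ^ 2 ≤ 10.24 := by
    nlinarith [Real.pi_lt_d2, Real.pi_pos]
  refine ⟨by field_simp; ring, ?_, ?_⟩
  · gcongr
    linarith
  · nlinarith [sq_nonneg Real.pi]

lemma le_levels_sq (n : ℕ) : Real.pi ^ 2 * (3 / 10) * n ≤ (levels n : ℝ) ^ 2 := by
  obtain ⟨h1, h2, -⟩ := levels_const_bounds
  have h := Nat.le_ceil (Real.sqrt (Real.pi ^ 2 * (Real.log 2 - 3 / 8) * n))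
  rw [levels, h1]
  have h0 : 0 ≤ Real.pi ^ 2 * (Real.log 2 - 3 / 8) * n :=
    mul_nonneg (le_trans (by positivity) h2) n.cast_nonneg
  calc Real.pi ^ 2 * (3 / 10) * n ≤ Real.pi ^ 2 * (Real.log 2 - 3 / 8) * n := by gcongr
    _ = Real.sqrt (Real.pi ^ 2 * (Real.log 2 - 3 / 8) * n) ^ 2 := (Real.sq_sqrt h0).symm
    _ ≤ _ := by gcongr

lemma two_le_levels {n : ℕ} (hn : 0 < n) : 2 ≤ levels n := by
  have h := le_levels_sq n
  have hn' : (1 : ℝ) ≤ n := by exact_mod_cast hn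
  have hpi := Real.pi_gt_three
  by_contra! hlt
  have h1 : (levels n : ℝ) ≤ 1 := by exact_mod_cast Nat.lt_succ_iff.mp hlt
  nlinarith [(levels n).cast_nonneg (α := ℝ), sq_nonneg Real.pi]

lemma logb_levels_le {n : ℕ} (hn : 0 < n) :
    Real.logb 2 (levels n) ≤ Real.logb 2 n / 2 + 2 := by
  obtain ⟨h1, h2, h3⟩ := levels_const_bounds
  have hn' : (1 : ℝ) ≤ n := by exact_mod_cast hn
  have hs : (1 : ℝ) ≤ Real.sqrt n := Real.one_le_sqrt.mpr hn'
  have h4 : (levels n : ℝ) ≤ 4 * Real.sqrt n := by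
    have h := (Nat.ceil_lt_add_one
      (Real.sqrt_nonneg (Real.pi ^ 2 * (Real.log 2 - 3 / 8) * n))).le
    have h5 : Real.sqrt (Real.pi ^ 2 * (Real.log 2 - 3 / 8) * n) ≤ 3 * Real.sqrt n := by
      rw [Real.sqrt_le_left (by positivity), mul_pow, Real.sq_sqrt n.cast_nonneg]
      nlinarith
    rw [levels, h1]
    linarith
  have h0 : (0 : ℝ) < levels n := by
    exact_mod_cast lt_of_lt_of_le two_pos (two_le_levels hn)
  calc Real.logb 2 (levels n) ≤ Real.logb 2 (4 * Real.sqrt n) :=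
        Real.logb_le_logb_of_le (by norm_num) h0 h4
    _ = Real.logb 2 n / 2 + 2 := by
        rw [Real.logb_mul (by norm_num) (by positivity),
          show (4 : ℝ) = 2 ^ (2 : ℕ) by norm_num, Real.logb_pow,
          Real.logb_self_eq_one (by norm_num), Real.logb, Real.logb,
          Real.log_sqrt (by positivity)]
        push_cast
        ring

lemma binIndex_lt {K : ℕ} (hK : 0 < K) (θ : ℝ) : binIndex K θ < K :=
  lt_of_le_of_lt (min_le_right _ _) (Nat.sub_lt hK one_pos)

/-- The angle of a representation level keeps the distance `π / (4 K)` from `0` and `π / 2`. -/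
lemma repLevel_angle_bounds {K k : ℕ} (hk : k < K) :
    Real.pi / (4 * K) ≤ Real.pi * (2 * k + 1) / (4 * K) ∧
      Real.pi * (2 * k + 1) / (4 * K) ≤ Real.pi / 2 - Real.pi / (4 * K) := by
  have hK : (0 : ℝ) < K := by exact_mod_cast (Nat.zero_le k).trans_lt hk
  have hk' : (k : ℝ) + 1 ≤ K := by exact_mod_cast hk
  have hpi := Real.pi_pos
  constructor
  · gcongr
    nlinarith [k.cast_nonneg (α := ℝ)]
  · rw [le_sub_iff_add_le, ← add_div, div_le_div_iff₀ (by positivity) two_pos]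
    nlinarith

lemma repLevel_mem_Ioo {K k : ℕ} (hk : k < K) : repLevel K k ∈ Set.Ioo (0 : ℝ) 1 := by
  obtain ⟨h1, h2⟩ := repLevel_angle_bounds hk
  have hK : (0 : ℝ) < K := by exact_mod_cast (Nat.zero_le k).trans_lt hk
  have hd : 0 < Real.pi / (4 * K) := by positivity
  have hs := Real.sin_pos_of_pos_of_lt_pi (hd.trans_le h1) (by linarith [Real.pi_pos])
  have hc := Real.cos_pos_of_mem_Ioo (x := Real.pi * (2 * k + 1) / (4 * K))
    ⟨by linarith [Real.pi_pos], by linarith⟩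
  have := Real.sin_sq_add_cos_sq (Real.pi * (2 * k + 1) / (4 * K))
  exact ⟨by unfold repLevel; positivity, by unfold repLevel; nlinarith⟩

lemma quantParam_mem_Ioo {n : ℕ} (hn : 0 < n) (cnt : List Bool → Bool → ℕ) (s : List Bool) :
    quantParam n cnt s ∈ Set.Ioo (0 : ℝ) 1 :=
  repLevel_mem_Ioo (binIndex_lt (two_pos.trans_le (two_le_levels hn)) _)

/-- In the coordinate `arcsin √θ`, which makes Jeffreys' prior uniform, a parameter and its
representation level differ by at most half a bin. -/
lemma abs_arcsin_sqrt_sub_le {K : ℕ} (hK : 0 < K) (θ : ℝ) :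
    |Real.arcsin (Real.sqrt θ) - Real.pi * (2 * (binIndex K θ : ℕ) + 1) / (4 * K)| ≤
      Real.pi / (4 * K) := by
  have hK' : (0 : ℝ) < K := by exact_mod_cast hK
  have hpi := Real.pi_pos
  set a := Real.arcsin (Real.sqrt θ) with ha
  have ha0 : 0 ≤ a := Real.arcsin_nonneg.mpr (Real.sqrt_nonneg _)
  have ha1 : a ≤ Real.pi / 2 := Real.arcsin_le_pi_div_two _
  have hx : (K : ℝ) * jeffreysCDF θ = 2 * K * a / Real.pi := by
    rw [jeffreysCDF, ← ha]; field_simp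
  have hx0 : 0 ≤ 2 * K * a / Real.pi := by positivity
  have hxK : 2 * K * a / Real.pi ≤ K := by
    rw [div_le_iff₀ hpi]; nlinarith
  have hlow : (binIndex K θ : ℝ) ≤ 2 * K * a / Real.pi := by
    rw [← hx] at hx0 ⊢
    exact le_trans (by exact_mod_cast min_le_left _ _) (Nat.floor_le hx0)
  have hup : 2 * K * a / Real.pi ≤ (binIndex K θ : ℝ) + 1 := by
    rw [← hx] at hxK hx0 ⊢
    unfold binIndex
    rcases le_total ⌊(K : ℝ) * jeffreysCDF θ⌋₊ (K - 1) with h | h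
    · rw [min_eq_left h]
      exact (Nat.lt_floor_add_one _).le
    · rw [min_eq_right h]
      have : ((K - 1 : ℕ) : ℝ) + 1 = K := by exact_mod_cast Nat.sub_add_cancel hK
      linarith
  rw [le_div_iff₀ hpi] at hlow
  rw [div_le_iff₀ hpi] at hup
  have e1 : a - Real.pi * (2 * (binIndex K θ : ℕ) + 1) / (4 * K) =
      (4 * K * a - Real.pi * (2 * (binIndex K θ : ℕ) + 1)) / (4 * K) := by
    field_simp
  rw [e1, abs_div, abs_of_pos (show (0 : ℝ) < 4 * K by positivity)]
  gcongr
  rw [abs_le]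
  constructor <;> nlinarith

/-- With `θ = sin² a` and `r = sin² b`, the `χ²`-distance of the parameters is
`4 sin² (a + b) sin² (a - b) / sin² (2 b)`, and `sin (a + b) ≤ 2 sin (2 b)` when `a` and `b` lie in
a bin with centre `b`. -/
lemma sq_sub_repLevel_le {K : ℕ} (hK : 0 < K) {θ : ℝ} (h0 : 0 ≤ θ) (h1 : θ ≤ 1) :
    (θ - repLevel K (binIndex K θ)) ^ 2 ≤
      (Real.pi / K) ^ 2 *
        (repLevel K (binIndex K θ) * (1 - repLevel K (binIndex K θ))) := by
  have hK' : (0 : ℝ) < K := by exact_mod_cast hK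
  have habs := abs_arcsin_sqrt_sub_le hK θ
  obtain ⟨hb1, hb2⟩ := repLevel_angle_bounds (binIndex_lt hK θ)
  set a := Real.arcsin (Real.sqrt θ) with ha
  unfold repLevel
  set b := Real.pi * (2 * (binIndex K θ : ℕ) + 1) / (4 * K) with hb
  set d := Real.pi / (4 * K) with hd
  have hd0 : 0 < d := by positivity
  have hsa : Real.sin a ^ 2 = θ := by
    rw [ha, Real.sin_arcsin (by linarith [Real.sqrt_nonneg θ]) (Real.sqrt_le_one.mpr h1),
      Real.sq_sqrt h0]
  have hpi := Real.pi_pos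
  -- the sine of the angular distance is at most that of half a bin, hence at most `sin (2 b)`
  have hsd : |Real.sin (a - b)| ≤ Real.sin d := by
    obtain ⟨l, u⟩ := abs_le.mp habs
    rw [abs_le, ← Real.sin_neg]
    constructor <;> apply Real.sin_le_sin_of_le_of_le_pi_div_two <;> linarith
  have hs2b : Real.sin d ≤ Real.sin (2 * b) := by
    rcases le_total (2 * b) (Real.pi / 2) with h | h
    · apply Real.sin_le_sin_of_le_of_le_pi_div_two <;> linarith
    · rw [← Real.sin_pi_sub (2 * b)]
      apply Real.sin_le_sin_of_le_of_le_pi_div_two <;> linarith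
  have hsd' : Real.sin d ≤ d := Real.sin_le hd0.le
  have hsum : |Real.sin (a + b)| ≤ 2 * Real.sin (2 * b) := by
    have e : Real.sin (a + b) =
        Real.sin (2 * b) * Real.cos (a - b) + Real.cos (2 * b) * Real.sin (a - b) := by
      rw [← Real.sin_add]; congr 1; ring
    have h2b : 0 ≤ Real.sin (2 * b) := (abs_nonneg _).trans (hsd.trans hs2b)
    rw [e]
    calc _ ≤ |Real.sin (2 * b) * Real.cos (a - b)| + |Real.cos (2 * b) * Real.sin (a - b)| :=
          abs_add_le _ _
      _ = Real.sin (2 * b) * |Real.cos (a - b)| + |Real.cos (2 * b)| * |Real.sin (a - b)| := by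
          rw [abs_mul, abs_mul, abs_of_nonneg h2b]
      _ ≤ Real.sin (2 * b) * 1 + 1 * Real.sin (2 * b) := by
          gcongr
          · exact Real.abs_cos_le_one _
          · exact Real.abs_cos_le_one _
          · exact hsd.trans hs2b
      _ = _ := by ring
  have ediff : Real.sin a ^ 2 - Real.sin b ^ 2 = Real.sin (a + b) * Real.sin (a - b) := by
    rw [Real.sin_add, Real.sin_sub]
    nlinarith [Real.sin_sq_add_cos_sq a, Real.sin_sq_add_cos_sq b]
  have evar : Real.sin b ^ 2 * (1 - Real.sin b ^ 2) = Real.sin (2 * b) ^ 2 / 4 := by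
    rw [Real.sin_two_mul]
    linear_combination (-Real.sin b ^ 2) * Real.sin_sq_add_cos_sq b
  rw [← hsa, ediff, evar, mul_pow, ← sq_abs (Real.sin (a + b)), ← sq_abs (Real.sin (a - b))]
  calc |Real.sin (a + b)| ^ 2 * |Real.sin (a - b)| ^ 2
      ≤ (2 * Real.sin (2 * b)) ^ 2 * d ^ 2 := by
        gcongr
        exact hsd.trans hsd'
    _ = (Real.pi / K) ^ 2 * (Real.sin (2 * b) ^ 2 / 4) := by
        rw [hd]; field_simp; ring

lemma mlParam_mem_Icc (cnt : List Bool → Bool → ℕ) (s : List Bool) :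
    mlParam cnt s ∈ Set.Icc (0 : ℝ) 1 := by
  unfold mlParam
  refine ⟨by positivity, div_le_one_of_le₀ ?_ (by positivity)⟩
  linarith [(cnt s false).cast_nonneg (α := ℝ)]

lemma mlParam_mul_total (cnt : List Bool → Bool → ℕ) (s : List Bool) :
    mlParam cnt s * ((cnt s false : ℝ) + cnt s true) = cnt s true := by
  unfold mlParam
  rcases eq_or_ne ((cnt s false : ℝ) + cnt s true) 0 with h | h
  · rw [h, mul_zero]
    linarith [(cnt s false).cast_nonneg (α := ℝ), (cnt s true).cast_nonneg (α := ℝ)]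
  · field_simp

/-- The bound `log x ≤ x - 1` for a ratio, weighted, in bits. -/
lemma mul_logb_sub_logb_le {c x y : ℝ} (hc : 0 ≤ c) (hx : 0 < c → 0 < x) (hy : 0 < c → 0 < y) :
    c * (Real.logb 2 x - Real.logb 2 y) ≤ c * (x / y - 1) / Real.log 2 := by
  rcases hc.eq_or_lt with rfl | hc
  · simp
  have hx := hx hc
  have hy := hy hc
  rw [← Real.logb_div hx.ne' hy.ne', Real.logb, mul_div_assoc]
  gcongr
  exact Real.log_le_sub_one_of_pos (div_pos hx hy)

lemma mlParam_pos (cnt : List Bool → Bool → ℕ) (s : List Bool)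
    (h : 0 < (cnt s true : ℝ)) : 0 < mlParam cnt s := by
  unfold mlParam
  positivity

lemma mlParam_lt_one (cnt : List Bool → Bool → ℕ) (s : List Bool)
    (h : 0 < (cnt s false : ℝ)) : mlParam cnt s < 1 := by
  unfold mlParam
  rw [div_lt_one (by positivity)]
  linarith

/-- The extra cost of a wrong parameter is at most the `χ²`-distance to it. -/
lemma stateLength_sub_mlParam_le (cnt : List Bool → Bool → ℕ) (s : List Bool) {r : ℝ}
    (hr : r ∈ Set.Ioo (0 : ℝ) 1) :
    stateLength cnt s r - stateLength cnt s (mlParam cnt s) ≤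
      ((cnt s false : ℝ) + cnt s true) * ((mlParam cnt s - r) ^ 2 / (r * (1 - r))) /
        Real.log 2 := by
  obtain ⟨hr0, hr1⟩ := hr
  have h1r : 0 < 1 - r := sub_pos.mpr hr1
  have hA := mul_logb_sub_logb_le (c := cnt s true) (x := mlParam cnt s) (y := r)
    (Nat.cast_nonneg _) (mlParam_pos cnt s) (fun _ => hr0)
  have hB := mul_logb_sub_logb_le (c := cnt s false) (x := 1 - mlParam cnt s) (y := 1 - r)
    (Nat.cast_nonneg _) (fun h => sub_pos.mpr (mlParam_lt_one cnt s h)) (fun _ => h1r)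
  have hθ := mlParam_mul_total cnt s
  set θ := mlParam cnt s
  have e : ((cnt s false : ℝ) + cnt s true) * ((θ - r) ^ 2 / (r * (1 - r))) =
      cnt s true * (θ / r - 1) + cnt s false * ((1 - θ) / (1 - r) - 1) := by
    have hf : (cnt s false : ℝ) = ((cnt s false : ℝ) + cnt s true) * (1 - θ) := by linarith
    have ht : (cnt s true : ℝ) = ((cnt s false : ℝ) + cnt s true) * θ := by linarith
    generalize (cnt s false : ℝ) + cnt s true = n at *
    rw [hf, ht]
    field_simp
    ring
  rw [e, add_div]
  unfold stateLength
  linarith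

/-- Gibbs' inequality: no parameter describes the data better than the maximum likelihood one. The
last two hypotheses exclude the infinite code lengths, for which `Real.logb` has a junk value. -/
lemma stateLength_mlParam_le (cnt : List Bool → Bool → ℕ) (s : List Bool) {p : ℝ}
    (hp : p ∈ Set.Icc (0 : ℝ) 1) (hp1 : 0 < (cnt s true : ℝ) → 0 < p)
    (hp0 : 0 < (cnt s false : ℝ) → p < 1) :
    stateLength cnt s (mlParam cnt s) ≤ stateLength cnt s p := by
  have hA := mul_logb_sub_logb_le (c := cnt s true) (x := p) (y := mlParam cnt s)
    (Nat.cast_nonneg _) hp1 (mlParam_pos cnt s)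
  have hB := mul_logb_sub_logb_le (c := cnt s false) (x := 1 - p) (y := 1 - mlParam cnt s)
    (Nat.cast_nonneg _) (fun h => sub_pos.mpr (hp0 h))
    (fun h => sub_pos.mpr (mlParam_lt_one cnt s h))
  have hθ := mlParam_mul_total cnt s
  have hθ1 := mlParam_pos cnt s
  have hθ0 := mlParam_lt_one cnt s
  unfold stateLength
  set θ := mlParam cnt s
  have hn0 := (cnt s false).cast_nonneg (α := ℝ)
  have hn1 := (cnt s true).cast_nonneg (α := ℝ)
  set n₀ := (cnt s false : ℝ)
  set n₁ := (cnt s true : ℝ)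
  have hA' : n₁ * (p / θ - 1) ≤ (n₀ + n₁) * p - n₁ := by
    rcases hn1.eq_or_lt with h | h
    · rw [← h, zero_mul, sub_zero]
      exact mul_nonneg (by linarith) hp.1
    · have := hθ1 h
      rw [mul_sub, mul_one, sub_le_sub_iff_right, ← mul_div_assoc, div_le_iff₀ this]
      exact le_of_eq (by linear_combination (-p) * hθ)
  have hB' : n₀ * ((1 - p) / (1 - θ) - 1) ≤ (n₀ + n₁) * (1 - p) - n₀ := by
    rcases hn0.eq_or_lt with h | h
    · rw [← h, zero_mul, sub_zero]
      exact mul_nonneg (by linarith) (sub_nonneg.mpr hp.2)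
    · have := sub_pos.mpr (hθ0 h)
      rw [mul_sub, mul_one, sub_le_sub_iff_right, ← mul_div_assoc, div_le_iff₀ this]
      have hf : n₀ = (n₀ + n₁) * (1 - θ) := by linarith
      exact le_of_eq (by linear_combination (1 - p) * hf)
  have hsum : n₁ * (p / θ - 1) / Real.log 2 + n₀ * ((1 - p) / (1 - θ) - 1) / Real.log 2 ≤ 0 := by
    rw [← add_div]
    exact div_nonpos_of_nonpos_of_nonneg (by linarith) (Real.log_pos one_lt_two).le
  linarith

/-- Quantization costs at most five bits per state, because the `χ²`-distance of a parameter to its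
representation level is `O(1 / K²) = O(1 / n)`. -/
lemma stateLength_quantParam_le {n : ℕ} (hn : 0 < n) (cnt : List Bool → Bool → ℕ) (s : List Bool)
    (hcnt : cnt s false + cnt s true ≤ n) :
    stateLength cnt s (quantParam n cnt s) ≤ stateLength cnt s (mlParam cnt s) + 5 := by
  have hK := two_pos.trans_le (two_le_levels hn)
  have hK' : (0 : ℝ) < levels n := by exact_mod_cast hK
  have hr := quantParam_mem_Ioo hn cnt s
  obtain ⟨h0, h1⟩ := mlParam_mem_Icc cnt s
  have h := stateLength_sub_mlParam_le cnt s hr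
  have hq : (mlParam cnt s - quantParam n cnt s) ^ 2 /
      (quantParam n cnt s * (1 - quantParam n cnt s)) ≤ (Real.pi / levels n) ^ 2 := by
    rw [div_le_iff₀ (mul_pos hr.1 (sub_pos.mpr hr.2))]
    exact sq_sub_repLevel_le hK h0 h1
  have hcnt' : ((cnt s false : ℝ) + cnt s true) ≤ n := by exact_mod_cast hcnt
  have hl := Real.log_two_gt_d9
  have key : ((cnt s false : ℝ) + cnt s true) * ((mlParam cnt s - quantParam n cnt s) ^ 2 /
      (quantParam n cnt s * (1 - quantParam n cnt s))) / Real.log 2 ≤ 5 := by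
    rw [div_le_iff₀ (by linarith)]
    calc _ ≤ (n : ℝ) * (Real.pi / levels n) ^ 2 := by
          gcongr
          exact div_nonneg (sq_nonneg _) (mul_pos hr.1 (sub_pos.mpr hr.2)).le
      _ = Real.pi ^ 2 * n / (levels n : ℝ) ^ 2 := by field_simp
      _ ≤ 10 / 3 := by
          rw [div_le_iff₀ (by positivity)]
          linarith [le_levels_sq n]
      _ ≤ _ := by linarith
  linarith

end TreeMDL

/-! ### Context trees and their natural code -/

namespace ContextTree

lemma numStates_pos : ∀ S : ContextTree, 0 < S.numStates
  | leaf => by simp [numStates, states]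
  | node t₀ t₁ => by
      have := numStates_pos t₀
      simp only [numStates, states, List.length_append, List.length_map] at *
      omega

lemma states_nodup : ∀ S : ContextTree, S.states.Nodup
  | leaf => by simp [states]
  | node t₀ t₁ => by
      rw [states, List.nodup_append]
      refine ⟨(states_nodup t₀).map (List.cons_injective),
        (states_nodup t₁).map (List.cons_injective), ?_⟩
      simp only [List.mem_map]
      rintro _ ⟨u, -, rfl⟩ _ ⟨v, -, rfl⟩
      simp

/-- A sufficiently long past has exactly one prefix among the states, the generator state. -/
lemma mem_states_and_prefix_iff : ∀ (S : ContextTree) (h : List Bool), S.depth ≤ h.length →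
    ∀ s, (s ∈ S.states ∧ s <+: h) ↔ s = S.generator h
  | leaf, h, _, s => by
      simp only [states, generator, List.mem_singleton]
      exact ⟨fun h => h.1, fun e => ⟨e, e ▸ List.nil_prefix⟩⟩
  | node t₀ t₁, [], hd, s => by simp [depth] at hd
  | node t₀ t₁, false :: h, hd, s => by
      have ih := mem_states_and_prefix_iff t₀ h (by simp [depth] at hd; omega)
      simp only [states, generator, List.mem_append, List.mem_map]
      constructor
      · rintro ⟨⟨u, hu, rfl⟩ | ⟨u, hu, rfl⟩, hp⟩
        · rw [List.cons_prefix_cons] at hp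
          rw [(ih u).mp ⟨hu, hp.2⟩]
        · simp [List.cons_prefix_cons] at hp
      · rintro rfl
        obtain ⟨h1, h2⟩ := (ih _).mpr rfl
        exact ⟨Or.inl ⟨_, h1, rfl⟩, by simpa [List.cons_prefix_cons] using h2⟩
  | node t₀ t₁, true :: h, hd, s => by
      have ih := mem_states_and_prefix_iff t₁ h (by simp [depth] at hd; omega)
      simp only [states, generator, List.mem_append, List.mem_map]
      constructor
      · rintro ⟨⟨u, hu, rfl⟩ | ⟨u, hu, rfl⟩, hp⟩
        · simp [List.cons_prefix_cons] at hp
        · rw [List.cons_prefix_cons] at hp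
          rw [(ih u).mp ⟨hu, hp.2⟩]
      · rintro rfl
        obtain ⟨h1, h2⟩ := (ih _).mpr rfl
        exact ⟨Or.inr ⟨_, h1, rfl⟩, by simpa [List.cons_prefix_cons] using h2⟩

lemma generator_mem_states (S : ContextTree) {h : List Bool} (hd : S.depth ≤ h.length) :
    S.generator h ∈ S.states :=
  ((mem_states_and_prefix_iff S h hd _).mpr rfl).1

/-- The natural code has at most one bit per node, and a full binary tree with `k` leaves has
`2 k - 1` nodes. -/
lemma length_natural_add_one_le (S : ContextTree) :
    ∀ D, (S.natural D).length + 1 ≤ 2 * S.numStates := by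
  induction S with
  | leaf => intro D; cases D <;> simp [natural, numStates, states]
  | node t₀ t₁ ih₀ ih₁ =>
    intro D
    have e : (node t₀ t₁).numStates = t₀.numStates + t₁.numStates := by simp [numStates, states]
    cases D with
    | zero => have := numStates_pos t₀; simp [natural]; omega
    | succ D =>
      have h₀ := ih₀ D
      have h₁ := ih₁ D
      simp only [natural, List.length_cons, List.length_append]
      omega

/-- The natural code of the trees of depth at most `D` is prefix-free. -/
lemma natural_append_inj : ∀ (D : ℕ) {S S' : ContextTree} {t t' : List Bool}, S.depth ≤ D →
    S'.depth ≤ D → S.natural D ++ t = S'.natural D ++ t' → S = S' ∧ t = t' := by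
  intro D
  induction D with
  | zero =>
    intro S S' t t' h h' e
    cases S <;> cases S' <;> simp_all [depth, natural]
  | succ D ih =>
    intro S S' t t' h h' e
    cases S with
    | leaf => cases S' <;> simp_all [natural]
    | node t₀ t₁ =>
      cases S' with
      | leaf => simp [natural] at e
      | node u₀ u₁ =>
        simp only [natural, depth, List.cons_append, List.append_assoc, List.cons.injEq,
          true_and] at e h h'
        obtain ⟨rfl, e₁⟩ := ih (by omega) (by omega) e
        obtain ⟨rfl, e₂⟩ := ih (by omega) (by omega) e₁
        exact ⟨rfl, e₂⟩

end ContextTree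

/-! ### Arithmetic coding -/

namespace TreeMDL

/-- The number in `[0, 1)` whose binary expansion after the point is the given list of digits. -/
noncomputable def bitValue : List Bool → ℝ
  | [] => 0
  | b :: t => ((b.toNat : ℝ) + bitValue t) / 2

lemma bitValue_mem_Ico : ∀ t : List Bool, bitValue t ∈ Set.Ico (0 : ℝ) 1
  | [] => by simp [bitValue]
  | b :: t => by
      obtain ⟨h0, h1⟩ := bitValue_mem_Ico t
      cases b <;> simp only [bitValue, Bool.toNat_true, Bool.toNat_false, Nat.cast_zero,
        Nat.cast_one, Set.mem_Ico] <;> constructor <;> linarith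

lemma bitValue_append (u t : List Bool) :
    bitValue (u ++ t) = bitValue u + bitValue t / 2 ^ u.length := by
  induction u with
  | nil => simp [bitValue]
  | cons b u ih =>
    simp only [List.cons_append, bitValue, ih, List.length_cons, pow_succ]
    field_simp
    ring

@[simp]
lemma length_fixedWidth (w v : ℕ) : (fixedWidth w v).length = w := by simp [fixedWidth]

lemma bitValue_fixedWidth (w v : ℕ) :
    bitValue (fixedWidth w v) = ((v % 2 ^ w : ℕ) : ℝ) / 2 ^ w := by
  induction w with
  | zero => simp [fixedWidth, bitValue, Nat.mod_one]
  | succ w ih =>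
    have e : fixedWidth (w + 1) v = v.testBit w :: fixedWidth w v := by
      simp only [fixedWidth, List.ofFn_succ]
      congr 2
      funext i
      congr 1
      simp only [Fin.val_succ]
      omega
    rw [e, bitValue, ih, Nat.mod_pow_succ, ← Nat.toNat_testBit, pow_succ]
    push_cast
    field_simp
    ring

lemma fixedWidth_inj {w v v' : ℕ} (hv : v < 2 ^ w) (hv' : v' < 2 ^ w)
    (h : fixedWidth w v = fixedWidth w v') : v = v' := by
  have := congrArg bitValue h
  rw [bitValue_fixedWidth, bitValue_fixedWidth, Nat.mod_eq_of_lt hv, Nat.mod_eq_of_lt hv',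
    div_left_inj' (by positivity)] at this
  exact_mod_cast this

/-- All bit strings that start with the codeword of a subinterval of `[0, 1)` are binary expansions
of points of this subinterval. -/
lemma bitValue_intervalCode_append_mem {I : ℝ × ℝ} (h0 : 0 ≤ I.1) (hw : 0 < I.2)
    (h1 : I.1 + I.2 ≤ 1) (t : List Bool) :
    bitValue (intervalCode I ++ t) ∈ Set.Ico I.1 (I.1 + I.2) := by
  obtain ⟨l, w⟩ := I
  simp only at h0 hw h1 ⊢
  set m := ⌈-Real.logb 2 w⌉₊ + 1 with hm
  have hp : (0 : ℝ) < 2 ^ m := by positivity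
  have hmw : 1 ≤ w / 2 * 2 ^ m := by
    have h := Nat.le_ceil (-Real.logb 2 w)
    have h2 : w⁻¹ ≤ (2 : ℝ) ^ ⌈-Real.logb 2 w⌉₊ := by
      rw [← Real.logb_inv] at h ⊢
      rw [← Real.rpow_natCast]
      exact (Real.logb_le_iff_le_rpow one_lt_two (inv_pos.mpr hw)).mp h
    rw [inv_le_iff_one_le_mul₀ hw] at h2
    rw [hm, pow_succ]
    linarith
  have hv0 : 0 ≤ (l + w / 2) * 2 ^ m := by positivity
  have hle := Nat.floor_le hv0
  have hlt := Nat.lt_floor_add_one ((l + w / 2) * 2 ^ m)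
  have hval : intervalCode (l, w) = fixedWidth m ⌊(l + w / 2) * 2 ^ m⌋₊ := rfl
  set v := ⌊(l + w / 2) * 2 ^ m⌋₊
  have hv : v < 2 ^ m := by
    have : (v : ℝ) < 2 ^ m := by
      refine hle.trans_lt ?_
      nlinarith
    exact_mod_cast this
  obtain ⟨ht0, ht1⟩ := bitValue_mem_Ico t
  rw [hval, bitValue_append, bitValue_fixedWidth, Nat.mod_eq_of_lt hv, length_fixedWidth,
    ← add_div]
  constructor
  · rw [le_div_iff₀ hp]
    nlinarith
  · rw [div_lt_iff₀ hp]
    nlinarith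

lemma arithInterval_congr {p q : List Bool → ℝ} : ∀ (u h : List Bool) (I : ℝ × ℝ),
    (∀ g : List Bool, h.length ≤ g.length → p g = q g) →
      arithInterval p h u I = arithInterval q h u I
  | [], _, _, _ => by simp [arithInterval]
  | b :: u, h, (l, w), hpq => by
      have h' : ∀ g : List Bool, (b :: h).length ≤ g.length → p g = q g :=
        fun g hg => hpq g (by simp at hg; omega)
      cases b <;> simp only [arithInterval, hpq h le_rfl] <;>
        exact arithInterval_congr u _ _ h'

/-- Arithmetic coding narrows the interval. -/
lemma arithInterval_subset {p : List Bool → ℝ} (hp : ∀ h, p h ∈ Set.Ioo (0 : ℝ) 1) :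
    ∀ (u h : List Bool) (I : ℝ × ℝ), 0 < I.2 →
      I.1 ≤ (arithInterval p h u I).1 ∧ 0 < (arithInterval p h u I).2 ∧
        (arithInterval p h u I).1 + (arithInterval p h u I).2 ≤ I.1 + I.2
  | [], _, _, hw => by simpa [arithInterval] using hw
  | false :: u, h, (l, w), hw => by
      obtain ⟨hp0, hp1⟩ := hp h
      simp only at hw
      obtain ⟨a, b, c⟩ := arithInterval_subset hp u (false :: h) (l, w * (1 - p h))
        (mul_pos hw (sub_pos.mpr hp1))
      simp only [arithInterval] at a b c ⊢
      exact ⟨a, b, c.trans (by nlinarith)⟩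
  | true :: u, h, (l, w), hw => by
      obtain ⟨hp0, hp1⟩ := hp h
      simp only at hw
      obtain ⟨a, b, c⟩ := arithInterval_subset hp u (true :: h) (l + w * (1 - p h), w * p h)
        (mul_pos hw hp0)
      simp only [arithInterval] at a b c ⊢
      exact ⟨le_trans (by nlinarith) a, b, c.trans (by nlinarith)⟩

/-- The intervals of distinct strings of the same length are disjoint. -/
lemma arithInterval_disjoint {p : List Bool → ℝ} (hp : ∀ h, p h ∈ Set.Ioo (0 : ℝ) 1) {z : ℝ} :
    ∀ (u u' h : List Bool) (I : ℝ × ℝ), 0 < I.2 → u.length = u'.length →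
      z ∈ Set.Ico (arithInterval p h u I).1
        ((arithInterval p h u I).1 + (arithInterval p h u I).2) →
      z ∈ Set.Ico (arithInterval p h u' I).1
        ((arithInterval p h u' I).1 + (arithInterval p h u' I).2) → u = u'
  | [], u', _, _, _, hl, _, _ => (List.length_eq_zero_iff.mp hl.symm).symm
  | _ :: _, [], _, _, _, hl, _, _ => by simp at hl
  | b :: u, b' :: u', h, (l, w), hw, hl, hz, hz' => by
      obtain ⟨hp0, hp1⟩ := hp h
      simp only at hw
      have w₀ := mul_pos hw (sub_pos.mpr hp1)
      have w₁ := mul_pos hw hp0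
      have hl' : u.length = u'.length := by simpa using hl
      cases b <;> cases b' <;> simp only [arithInterval] at hz hz'
      · rw [arithInterval_disjoint hp u u' _ _ w₀ hl' hz hz']
      · exfalso
        obtain ⟨-, -, c⟩ := arithInterval_subset hp u (false :: h) (l, w * (1 - p h)) w₀
        obtain ⟨a, -, -⟩ :=
          arithInterval_subset hp u' (true :: h) (l + w * (1 - p h), w * p h) w₁
        simp only at a c
        linarith [hz.2, hz'.1]
      · exfalso
        obtain ⟨-, -, c⟩ := arithInterval_subset hp u' (false :: h) (l, w * (1 - p h)) w₀
        obtain ⟨a, -, -⟩ :=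
          arithInterval_subset hp u (true :: h) (l + w * (1 - p h), w * p h) w₁
        simp only at a c
        linarith [hz.1, hz'.2]
      · rw [arithInterval_disjoint hp u u' _ _ w₁ hl' hz hz']

/-- Arithmetic coding is prefix-free on the strings of a given length. -/
lemma arithCode_append_inj {p : List Bool → ℝ} (hp : ∀ h, p h ∈ Set.Ioo (0 : ℝ) 1)
    {h u u' t t' : List Bool} (hl : u.length = u'.length)
    (e : arithCode p h u ++ t = arithCode p h u' ++ t') : u = u' ∧ t = t' := by
  have hmem : ∀ v s : List Bool, bitValue (arithCode p h v ++ s) ∈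
      Set.Ico (arithInterval p h v (0, 1)).1
        ((arithInterval p h v (0, 1)).1 + (arithInterval p h v (0, 1)).2) := by
    intro v s
    obtain ⟨a, b, c⟩ := arithInterval_subset hp v h (0, 1) one_pos
    exact bitValue_intervalCode_append_mem a b (by simpa using c) s
  have hu : u = u' :=
    arithInterval_disjoint hp u u' h (0, 1) one_pos hl (hmem u t) (by rw [e]; exact hmem u' t')
  subst hu
  exact ⟨rfl, List.append_cancel_left e⟩

/-! ### Prefix-freeness of the block code and unique decodability -/

/-- A state determined by a past occurs in the list of bin indices, so that the decoder knows its
quantized parameter. -/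
lemma quantParam_eq_of_map_binIndex_eq {n : ℕ} {S : ContextTree} {cnt cnt' : List Bool → Bool → ℕ}
    (e : (S.states.map fun s => binIndex (levels n) (mlParam cnt s)) =
      S.states.map fun s => binIndex (levels n) (mlParam cnt' s))
    {h : List Bool} (hd : S.depth ≤ h.length) :
    quantParam n cnt (S.generator h) = quantParam n cnt' (S.generator h) := by
  have := List.map_inj_left.mp e _ (S.generator_mem_states hd)
  unfold quantParam
  rw [this]

/-- The block codewords, with the structures estimated from the blocks, are prefix-free. -/
lemma encodeBlock_append_inj {D M : ℕ} (hM : 0 < M) (hDM : D ≤ M)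
    {est : (Fin M → Bool) → ContextTree} (hest : ∀ y, (est y).depth ≤ D)
    (y y' : Fin M → Bool) (t t' : List Bool)
    (e : encodeBlock D (est y) y ++ t = encodeBlock D (est y') y' ++ t') : y = y' ∧ t = t' := by
  have hK : 1 < levels M := two_le_levels hM
  unfold encodeBlock at e
  simp only [List.append_assoc] at e
  obtain ⟨hS, e⟩ := ContextTree.natural_append_inj D (hest y) (hest y') e
  have hd := hest y
  rw [← hS] at e
  set S := est y
  obtain ⟨e₁, e⟩ := List.append_inj e (by simp)
  -- the integers fit into the field, so the bin indices can be read off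
  have hlt : ∀ cnt : List Bool → Bool → ℕ,
      Nat.ofDigits (levels M) (S.states.map fun s => binIndex (levels M) (mlParam cnt s)) <
        2 ^ Nat.clog 2 (levels M ^ S.numStates) := by
    intro cnt
    refine lt_of_lt_of_le (Nat.ofDigits_lt_base_pow_length hK ?_)
      (le_trans (le_of_eq ?_) (Nat.le_pow_clog one_lt_two _))
    · simp only [List.mem_map]
      rintro _ ⟨s, -, rfl⟩
      exact binIndex_lt (by omega) _
    · simp [ContextTree.numStates]
  have e₂ := Nat.ofDigits_inj_of_len_eq hK (by simp)
    (by
      simp only [List.mem_map]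
      rintro _ ⟨s, -, rfl⟩
      exact binIndex_lt (by omega) _)
    (by
      simp only [List.mem_map]
      rintro _ ⟨s, -, rfl⟩
      exact binIndex_lt (by omega) _)
    (fixedWidth_inj (hlt _) (hlt _) e₁)
  obtain ⟨e₃, e⟩ := List.append_inj e (by simp)
  have hpast : past y D = past y' D := by rw [past, past, e₃]
  have hlen : (past y D).length = D := by simp [past, hDM]
  rw [← hpast, arithCode, arithCode,
    arithInterval_congr (q := fun h => quantParam M (blockCount D y) (S.generator h))
      ((List.ofFn y').drop D) (past y D) (0, 1)
      (fun g hg => (quantParam_eq_of_map_binIndex_eq e₂ (by omega)).symm)] at e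
  obtain ⟨e₄, et⟩ := arithCode_append_inj (fun _ => quantParam_mem_Ioo hM _ _) (by simp) e
  refine ⟨List.ofFn_injective ?_, et⟩
  rw [← List.take_append_drop D (List.ofFn y), e₃, e₄, List.take_append_drop]

lemma encodeBlock_ne_nil (D : ℕ) {M : ℕ} (S : ContextTree) (y : Fin M → Bool) :
    encodeBlock D S y ≠ [] := by
  intro h
  have := congrArg List.length h
  simp [encodeBlock, arithCode, intervalCode] at this

/-- Concatenations of equally many codewords of a prefix-free code are prefix-free. -/
lemma flatten_map_append_inj {α β : Type*} {e : α → List β}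
    (he : ∀ a a' t t', e a ++ t = e a' ++ t' → a = a' ∧ t = t') :
    ∀ (L L' : List α) (t t' : List β), L.length = L'.length →
      (L.map e).flatten ++ t = (L'.map e).flatten ++ t' → L = L' ∧ t = t'
  | [], L', t, t', hl, h => by
      obtain rfl := List.length_eq_zero_iff.mp hl.symm
      simpa using h
  | _ :: _, [], _, _, hl, _ => by simp at hl
  | a :: L, a' :: L', t, t', hl, h => by
      simp only [List.map_cons, List.flatten_cons, List.append_assoc] at h
      obtain ⟨rfl, h₁⟩ := he _ _ _ _ h
      obtain ⟨rfl, h₂⟩ := flatten_map_append_inj he L L' t t' (by simpa using hl) h₁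
      exact ⟨rfl, h₂⟩

/-- A prefix-free code without an empty codeword is uniquely decodable. -/
lemma uniquelyDecodable_range_of_append_inj {α β : Type*} {e : α → List β} (hne : ∀ a, e a ≠ [])
    (he : ∀ a a' t t', e a ++ t = e a' ++ t' → a = a' ∧ t = t') :
    InformationTheory.UniquelyDecodable (Set.range e) := by
  intro L
  induction L with
  | nil =>
    intro L' _ h' h
    cases L' with
    | nil => rfl
    | cons w L' =>
      obtain ⟨a, rfl⟩ := h' w (by simp)
      simp [hne a] at h
  | cons w L ih =>
    intro L' hL h' h
    obtain ⟨a, rfl⟩ := hL w (by simp)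
    cases L' with
    | nil => simp [hne a] at h
    | cons w' L' =>
      obtain ⟨a', rfl⟩ := h' w' (by simp)
      obtain ⟨rfl, h₁⟩ := he a a' L.flatten L'.flatten (by simpa using h)
      rw [ih L' (fun w hw => hL w (by simp [hw])) (fun w hw => h' w (by simp [hw])) h₁]

lemma block_injective {B M : ℕ} {x x' : Fin (B * M) → Bool} (h : block x = block x') : x = x' := by
  funext i
  have := congrFun (congrFun h (finProdFinEquiv.symm i).1) (finProdFinEquiv.symm i).2
  simpa only [block, Prod.mk.eta, Equiv.apply_symm_apply] using this

/-- The naive parallel code is prefix-free. -/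
lemma naiveEncode_append_inj {D B M : ℕ} (hM : 0 < M) (hDM : D ≤ M)
    {est : (Fin M → Bool) → ContextTree} (hest : ∀ y, (est y).depth ≤ D)
    (x x' : Fin (B * M) → Bool) (t t' : List Bool)
    (e : naiveEncode D est x ++ t = naiveEncode D est x' ++ t') : x = x' ∧ t = t' := by
  have hmap : ∀ z : Fin (B * M) → Bool, naiveEncode D est z =
      ((List.ofFn (block z)).map fun y => encodeBlock D (est y) y).flatten := by
    intro z
    rw [naiveEncode, List.map_ofFn]
    rfl
  rw [hmap, hmap] at e
  obtain ⟨h, ht⟩ := flatten_map_append_inj (e := fun y => encodeBlock D (est y) y)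
    (encodeBlock_append_inj hM hDM hest) _ _ t t' (by simp) e
  exact ⟨block_injective (List.ofFn_injective h), ht⟩

lemma naiveEncode_ne_nil {D B M : ℕ} (hB : 0 < B) (est : (Fin M → Bool) → ContextTree)
    (x : Fin (B * M) → Bool) : naiveEncode D est x ≠ [] := by
  intro h
  rw [naiveEncode, List.flatten_eq_nil_iff] at h
  exact encodeBlock_ne_nil _ _ _ (h _ (List.mem_ofFn.mpr ⟨⟨0, hB⟩, rfl⟩))

end TreeMDL

/-! ### Lengths of the block codewords -/

namespace TreeMDL

/-- The ideal code length, in bits, of the symbol `b` when `1` has probability `q`. -/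
noncomputable def symbolLength (q : ℝ) (b : Bool) : ℝ := -Real.logb 2 (if b then q else 1 - q)

lemma past_succ {M : ℕ} (y : Fin M → Bool) (i : Fin M) : past y (i + 1) = y i :: past y i := by
  unfold past
  rw [List.take_succ_eq_append_getElem (by simp)]
  simp

lemma drop_ofFn {M : ℕ} (y : Fin M → Bool) (i : Fin M) :
    (List.ofFn y).drop i = y i :: (List.ofFn y).drop (i + 1) := by
  rw [List.drop_eq_getElem_cons (by simp)]
  simp

lemma filter_le_eq_insert {M : ℕ} (i : Fin M) :
    (Finset.univ.filter fun j : Fin M => (i : ℕ) ≤ j) =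
      insert i (Finset.univ.filter fun j : Fin M => (i : ℕ) + 1 ≤ j) := by
  ext j
  simp only [Finset.mem_filter, Finset.mem_univ, true_and, Finset.mem_insert, Fin.ext_iff]
  omega

/-- The width of the final interval is the product of the probabilities of the coded symbols. -/
lemma neg_logb_arithInterval {M : ℕ} (y : Fin M → Bool) {p : List Bool → ℝ}
    (hp : ∀ h, p h ∈ Set.Ioo (0 : ℝ) 1) (k : ℕ) :
    ∀ (i : ℕ) (l w : ℝ), i + k = M → 0 < w →
      -Real.logb 2 (arithInterval p (past y i) ((List.ofFn y).drop i) (l, w)).2 =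
        -Real.logb 2 w +
          ∑ j ∈ Finset.univ.filter (fun j : Fin M => i ≤ (j : ℕ)),
            symbolLength (p (past y j)) (y j) := by
  induction k with
  | zero =>
    intro i l w hi hw
    have : (Finset.univ.filter fun j : Fin M => i ≤ (j : ℕ)) = ∅ := by
      ext j
      simp
      omega
    rw [this, List.drop_eq_nil_of_le (by simp; omega)]
    simp [arithInterval]
  | succ k ih =>
    intro i l w hi hw
    obtain ⟨i, rfl⟩ : ∃ i' : Fin M, (i' : ℕ) = i := ⟨⟨i, by omega⟩, rfl⟩
    obtain ⟨hp0, hp1⟩ := hp (past y i)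
    have h1p := sub_pos.mpr hp1
    rw [filter_le_eq_insert, Finset.sum_insert (by simp), drop_ofFn]
    rcases hb : y i with _ | _
    · rw [arithInterval, ← hb, ← past_succ, ih _ _ _ (by omega) (mul_pos hw h1p),
        Real.logb_mul hw.ne' h1p.ne']
      simp only [symbolLength, hb, Bool.false_eq_true, if_false]
      ring
    · rw [arithInterval, ← hb, ← past_succ, ih _ _ _ (by omega) (mul_pos hw hp0),
        Real.logb_mul hw.ne' hp0.ne']
      simp only [symbolLength, hb, if_true]
      ring

lemma stateLength_blockCount (D : ℕ) {M : ℕ} (y : Fin M → Bool) (s : List Bool) (q : ℝ) :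
    stateLength (blockCount D y) s q =
      ∑ j : Fin M, if D ≤ (j : ℕ) ∧ s <+: past y j then symbolLength q (y j) else 0 := by
  unfold stateLength blockCount
  rw [Finset.card_filter, Finset.card_filter]
  push_cast
  rw [Finset.sum_mul, Finset.sum_mul, ← Finset.sum_neg_distrib, ← Finset.sum_sub_distrib]
  refine Finset.sum_congr rfl fun j _ => ?_
  by_cases h1 : D ≤ (j : ℕ) <;> by_cases h2 : s <+: past y j <;> rcases y j with _ | _ <;>
    simp [h1, h2, symbolLength]

/-- Every symbol after the first `D` is counted for exactly one state, its generator. -/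
lemma sum_stateLength_blockCount {D M : ℕ} (y : Fin M → Bool) {S : ContextTree}
    (hS : S.depth ≤ D) (q : List Bool → ℝ) :
    (S.states.map fun s => stateLength (blockCount D y) s (q s)).sum =
      ∑ j ∈ Finset.univ.filter (fun j : Fin M => D ≤ (j : ℕ)),
        symbolLength (q (S.generator (past y j))) (y j) := by
  rw [← List.sum_toFinset _ S.states_nodup]
  simp only [stateLength_blockCount]
  rw [Finset.sum_comm, Finset.sum_filter]
  refine Finset.sum_congr rfl fun j _ => ?_
  by_cases hj : D ≤ (j : ℕ)
  · have hlen : S.depth ≤ (past y j).length := by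
      simp only [past, List.length_reverse, List.length_take, List.length_ofFn]
      omega
    have hiff := S.mem_states_and_prefix_iff (past y j) hlen
    have hgen := (hiff _).mpr rfl
    rw [if_pos hj, Finset.sum_eq_single (S.generator (past y j)), if_pos ⟨hj, hgen.2⟩]
    · intro s hs hne
      exact if_neg fun h => hne ((hiff s).mp ⟨List.mem_toFinset.mp hs, h.2⟩)
    · intro h
      exact absurd (List.mem_toFinset.mpr hgen.1) h
  · simp [hj]

lemma blockCount_add_le (D : ℕ) {M : ℕ} (y : Fin M → Bool) (s : List Bool) :
    blockCount D y s false + blockCount D y s true ≤ M := by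
  unfold blockCount
  rw [← Finset.card_union_of_disjoint]
  · exact (Finset.card_le_univ _).trans (by simp)
  · rw [Finset.disjoint_filter]
    rintro i - ⟨-, h, -⟩ ⟨-, h', -⟩
    simp [h] at h'

lemma clog_pow_levels_le {n : ℕ} (hn : 0 < n) (k : ℕ) :
    (Nat.clog 2 (levels n ^ k) : ℝ) ≤ k * Real.logb 2 (levels n) + 1 := by
  have hK : (1 : ℝ) ≤ levels n := by exact_mod_cast one_le_two.trans (two_le_levels hn)
  rw [← Real.natCeil_logb_natCast]
  push_cast
  rw [Real.logb_pow]
  exact (Nat.ceil_lt_add_one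
    (mul_nonneg k.cast_nonneg (Real.logb_nonneg one_lt_two hK))).le

/-- Integer rounding makes the codeword at most three bits longer than the description length
together with the `D` uncoded symbols. -/
lemma length_encodeBlock_le {D M : ℕ} (hM : 0 < M) (hDM : D ≤ M) {S : ContextTree}
    (hS : S.depth ≤ D) (y : Fin M → Bool) :
    ((encodeBlock D S y).length : ℝ) ≤ mdlLength D M (blockCount D y) S + D + 3 := by
  have hp : ∀ h, (fun h => quantParam M (blockCount D y) (S.generator h)) h ∈ Set.Ioo (0 : ℝ) 1 :=
    fun _ => quantParam_mem_Ioo hM _ _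
  have hwidth := neg_logb_arithInterval y hp (M - D) D 0 1 (by omega) one_pos
  rw [Real.logb_one, neg_zero, zero_add, ← sum_stateLength_blockCount y hS] at hwidth
  obtain ⟨-, hw0, hw1⟩ := arithInterval_subset hp ((List.ofFn y).drop D) (past y D) (0, 1) one_pos
  obtain ⟨hl, -, -⟩ := arithInterval_subset hp ((List.ofFn y).drop D) (past y D) (0, 1) one_pos
  have hnn := Real.logb_nonpos one_lt_two hw0.le (by simp only at hl hw1; linarith)
  have hceil := Nat.ceil_lt_add_one (neg_nonneg.mpr hnn)
  have hclog := clog_pow_levels_le hM S.numStates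
  unfold encodeBlock mdlLength modelLength paramLength
  simp only [arithCode, intervalCode, List.length_append, length_fixedWidth, List.length_take,
    List.length_ofFn, min_eq_left hDM]
  push_cast
  linarith

lemma mdlLength_le_mlEntropy {D M : ℕ} (hM : 0 < M) (y : Fin M → Bool) (S : ContextTree) :
    mdlLength D M (blockCount D y) S ≤ mlEntropy (blockCount D y) S +
      (S.numStates / 2 * (Real.logb 2 M + 18) - 1) := by
  have h1 : (modelLength D S : ℝ) + 1 ≤ 2 * S.numStates := by
    exact_mod_cast S.length_natural_add_one_le D
  have h2 : paramLength M S ≤ S.numStates * (Real.logb 2 M / 2 + 2) :=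
    mul_le_mul_of_nonneg_left (logb_levels_le hM) (Nat.cast_nonneg _)
  have h3 : (S.states.map fun s =>
      stateLength (blockCount D y) s (quantParam M (blockCount D y) s)).sum ≤
      (S.states.map fun s =>
        stateLength (blockCount D y) s (mlParam (blockCount D y) s) + 5).sum :=
    List.sum_le_sum fun s _ => stateLength_quantParam_le hM _ s (blockCount_add_le D y s)
  rw [List.sum_map_add, List.map_const', List.sum_replicate, nsmul_eq_mul] at h3
  change _ ≤ mlEntropy (blockCount D y) S + (S.numStates : ℝ) * 5 at h3
  unfold mdlLength
  linarith

/-! ### The redundancy of naive parallel compression -/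

/-- Separate maximum likelihood parameters for the blocks describe them at least as well as common
ones. -/
lemma sum_mlEntropy_block_le (D : ℕ) {B M : ℕ} (x : Fin (B * M) → Bool) (S : ContextTree) :
    ∑ b : Fin B, mlEntropy (blockCount D (block x b)) S ≤ mlEntropy (totalCount D x) S := by
  have hlin : ∀ s p, stateLength (totalCount D x) s p =
      ∑ b : Fin B, stateLength (blockCount D (block x b)) s p := by
    intro s p
    unfold stateLength totalCount
    push_cast
    rw [Finset.sum_sub_distrib, Finset.sum_neg_distrib, Finset.sum_mul, Finset.sum_mul]
  have hle : ∀ (b : Fin B) s a,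
      (blockCount D (block x b) s a : ℝ) ≤ (totalCount D x s a : ℝ) := by
    intro b s a
    exact_mod_cast Finset.single_le_sum (f := fun b => blockCount D (block x b) s a)
      (fun _ _ => Nat.zero_le _) (Finset.mem_univ b)
  unfold mlEntropy
  simp only [← List.sum_toFinset _ S.states_nodup]
  rw [Finset.sum_comm]
  refine Finset.sum_le_sum fun s _ => ?_
  rw [hlin]
  exact Finset.sum_le_sum fun b _ => stateLength_mlParam_le _ s (mlParam_mem_Icc _ s)
    (fun h => mlParam_pos _ s (h.trans_le (hle b s true)))
    (fun h => mlParam_lt_one _ s (h.trans_le (hle b s false)))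

lemma length_naiveEncode (D : ℕ) {B M : ℕ} (est : (Fin M → Bool) → ContextTree)
    (x : Fin (B * M) → Bool) : ((naiveEncode D est x).length : ℝ) =
      ∑ b : Fin B, ((encodeBlock D (est (block x b)) (block x b)).length : ℝ) := by
  rw [naiveEncode, List.length_flatten, List.map_ofFn, List.sum_ofFn]
  push_cast
  rfl

lemma numStates_le_maxStates {B M : ℕ} (est : (Fin M → Bool) → ContextTree)
    (x : Fin (B * M) → Bool) (b : Fin B) : (est (block x b)).numStates ≤ maxStates est x :=
  Finset.le_sup (f := fun b : Fin B => (est (block x b)).numStates) (Finset.mem_univ b)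

lemma modelLength_le (D : ℕ) (S : ContextTree) :
    (modelLength D S : ℝ) ≤ 2 * S.numStates - 1 := by
  have : (modelLength D S : ℝ) + 1 ≤ 2 * S.numStates := by
    exact_mod_cast S.length_natural_add_one_le D
  linarith

lemma paramLength_le {n : ℕ} (hn : 0 < n) {C : ℝ} (hC : 4 ≤ C) (S : ContextTree) :
    paramLength n S ≤ S.numStates / 2 * (Real.logb 2 n + C) := by
  have h := mul_le_mul_of_nonneg_left (logb_levels_le hn) (S.numStates.cast_nonneg (α := ℝ))
  have h' := mul_le_mul_of_nonneg_left hC (S.numStates.cast_nonneg (α := ℝ))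
  unfold paramLength
  linarith

/-- A bound for every block gives `B` times this bound for the sequence. -/
lemma sum_le_card_mul {B : ℕ} {f : Fin B → ℝ} {c : ℝ} (h : ∀ b, f b ≤ c) :
    ∑ b, f b ≤ B * c := by
  simpa using Finset.sum_le_card_nsmul Finset.univ f c fun b _ => h b

end TreeMDL

theorem mainTheorem2 (δ : ℝ) (hδ : 0 ≤ δ) :
    ∃ C : ℝ, ∀ (B M D : ℕ), 0 < B → 0 < M → (D : ℝ) ≤ Real.logb 2 M →
      ∀ est : (Fin M → Bool) → ContextTree,
        (∀ y : Fin M → Bool, TreeMDL.IsMDL δ D M (TreeMDL.blockCount D y) (est y)) →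
        -- the encoder is a uniquely decodable code for the sequences of length `N = B * M`
        (Function.Injective
            (TreeMDL.naiveEncode D est : (Fin (B * M) → Bool) → List Bool) ∧
          InformationTheory.UniquelyDecodable
            (Set.range (TreeMDL.naiveEncode D est : (Fin (B * M) → Bool) → List Bool))) ∧
        ∀ x : Fin (B * M) → Bool,
          -- the redundancy over the entropy with respect to the estimated MDL structures
          TreeMDL.naiveRedundancy D est x ≤
              B * (Real.logb 2 M + 2) +
                B * ((TreeMDL.maxStates est x : ℝ) / 2 * (Real.logb 2 M + C)) ∧
          -- the redundancy over the entropy with respect to one structure for the whole sequence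
          (∀ S : ContextTree, S.depth ≤ D →
            TreeMDL.naiveRedundancyWrt D est S x ≤
              B * (Real.logb 2 M + 2) +
                B * ((S.numStates : ℝ) / 2 * (Real.logb 2 M + C))) ∧
          -- the model and the parameter redundancy of naive parallel compression
          (TreeMDL.naiveModelLength D est x : ℝ) ≤ B * (2 * (TreeMDL.maxStates est x : ℝ) - 1) ∧
          TreeMDL.naiveParamLength est x ≤
              B * ((TreeMDL.maxStates est x : ℝ) / 2 * (Real.logb 2 M + C)) ∧
          -- compared with those of PTP-MDL, which uses one MDL structure for the whole sequence
          (∀ S : ContextTree,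
            TreeMDL.IsMDL δ D (B * M) (TreeMDL.totalCount D x) S →
            (TreeMDL.modelLength D S : ℝ) ≤ 2 * (S.numStates : ℝ) - 1 ∧
            TreeMDL.paramLength (B * M) S ≤
              (S.numStates : ℝ) / 2 * (Real.logb 2 ((B * M : ℕ) : ℝ) + C) ∧
            ((∀ b : Fin B, est (TreeMDL.block x b) = S) →
              TreeMDL.naiveModelLength D est x = B * TreeMDL.modelLength D S ∧
              TreeMDL.naiveParamLength est x = B * TreeMDL.paramLength M S)) := by
  open TreeMDL in
  -- `18` bounds twice the cost per state: `2` bits of tree, `2` bits of `log₂ K - log₂ n / 2` and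
  -- `5` bits of quantization loss. The slack `δ` is absorbed since every tree has at least one state.
  refine ⟨18 + 2 * δ, fun B M D hB hM hD est hest => ?_⟩
  have hlog : 0 ≤ Real.logb 2 M := Real.logb_nonneg one_lt_two (by exact_mod_cast hM)
  have hDM : D ≤ M := by
    have h : (2 : ℝ) ^ D ≤ M := by
      rw [← Real.rpow_natCast]
      exact (Real.le_logb_iff_rpow_le one_lt_two (by exact_mod_cast hM)).mp hD
    exact (Nat.lt_two_pow_self (n := D)).le.trans (by exact_mod_cast h)
  have hdepth : ∀ y, (est y).depth ≤ D := fun y => (hest y).1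
  have hinj := naiveEncode_append_inj (B := B) hM hDM hdepth
  have hblock : ∀ y, ((encodeBlock D (est y) y).length : ℝ) ≤
      mdlLength D M (blockCount D y) (est y) + Real.logb 2 M + 3 :=
    fun y => (length_encodeBlock_le hM hDM (hdepth y) y).trans (by linarith)
  refine ⟨⟨fun x x' h => (hinj x x' [] [] (by rw [h])).1,
    uniquelyDecodable_range_of_append_inj (naiveEncode_ne_nil hB est) hinj⟩, fun x => ?_⟩
  have hmax : ∀ b : Fin B, ((est (block x b)).numStates : ℝ) ≤ maxStates est x :=
    fun b => by exact_mod_cast numStates_le_maxStates est x b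
  have hmono : ∀ b : Fin B, ((est (block x b)).numStates : ℝ) / 2 *
      (Real.logb 2 M + (18 + 2 * δ)) ≤
        (maxStates est x : ℝ) / 2 * (Real.logb 2 M + (18 + 2 * δ)) :=
    fun b => mul_le_mul_of_nonneg_right (by linarith [hmax b]) (by linarith)
  have hone : ∀ S : ContextTree, (1 : ℝ) ≤ S.numStates :=
    fun S => by exact_mod_cast S.numStates_pos
  refine ⟨?_, fun S hS => ?_, ?_, ?_, fun S _ => ⟨modelLength_le D S, ?_, fun hSb => ⟨?_, ?_⟩⟩⟩
  · rw [naiveRedundancy, length_naiveEncode, ← Finset.sum_sub_distrib, ← mul_add]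
    refine sum_le_card_mul fun b => ?_
    have h1 := hblock (block x b)
    have h2 := mdlLength_le_mlEntropy (D := D) hM (block x b) (est (block x b))
    have h3 := hmono b
    have h4 : 0 ≤ ((est (block x b)).numStates : ℝ) * δ := by positivity
    linarith
  · refine (sub_le_sub_left (sum_mlEntropy_block_le D x S) _).trans ?_
    rw [length_naiveEncode, ← Finset.sum_sub_distrib, ← mul_add]
    refine sum_le_card_mul fun b => ?_
    have h1 := hblock (block x b)
    have h2 := mdlLength_le_mlEntropy (D := D) hM (block x b) S
    have h3 := (hest (block x b)).2 S hS
    have h4 := mul_le_mul_of_nonneg_right (hone S) hδ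
    linarith
  · rw [naiveModelLength]
    push_cast
    exact sum_le_card_mul fun b => (modelLength_le D _).trans (by linarith [hmax b])
  · exact sum_le_card_mul fun b => (paramLength_le hM (by linarith) _).trans (hmono b)
  · exact paramLength_le (Nat.mul_pos hB hM) (by linarith) S
  · simp [naiveModelLength, hSb]
  · simp [naiveParamLength, hSb]
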